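/- Let $C$ be an arbitrary set of colors. An \emph{arena} $\mathcal A=(S_1,S_2,E)$ consists of a finite set of states $S=S_1\uplus S_2$, where $S_i$ is the set of states of player $\mathcal P_i$, and a finite set of edges $E\subseteq S\times C\times S$ such that every state is the source of at least one edge. A history is a finite sequence of consecutive edges from a given state (including the empty history at each state), and a play is an infinite sequence of consecutive edges. A \emph{strategy} of $\mathcal P_i$ maps each history ending in $S_i$ to an edge whose source is the last state of that history. For a state $s$ and strategies $\sigma_1,\sigma_2$ of the two players, let $\mathrm{w}(s,\sigma_1,\sigma_2)\in C^\omega$ be the sequence of colors of the unique play from $s$ consistent with both strategies. A \emph{preference relation} $\sqsubseteq$ is a total preorder on $C^\omega$. In the game $(\mathcal A,\sqsubseteq)$, a strategy $\sigma_1$ of $\mathcal P_1$ is \emph{optimal from} $s$ if for every strategy $\sigma_1'$ of $\mathcal P_1$, $$\{w\in C^\omega\mid \exists\sigma_2,\ \mathrm{w}(s,\sigma_1,\sigma_2)\sqsubseteq w\}\subseteq\{w\in C^\omega\mid \exists\sigma_2,\ \mathrm{w}(s,\sigma_1',\sigma_2)\sqsubseteq w\};$$ symmetrically, a strategy $\sigma_2$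 of $\mathcal P_2$ is optimal from $s$ if for every strategy $\sigma_2'$ of $\mathcal P_2$, $$\{w\in C^\omega\mid \exists\sigma_1,\ w\sqsubseteq \mathrm{w}(s,\sigma_1,\sigma_2)\}\subseteq\{w\in C^\omega\mid \exists\sigma_1,\ w\sqsubseteq \mathrm{w}(s,\sigma_1,\sigma_2')\}.$$ A strategy is \emph{uniformly optimal} if it is optimal from every state. A \emph{memory skeleton} $\mathcal M=(M,m_{\mathsf{init}},\alpha_{\mathsf{upd}})$ consists of a finite set $M$, an initial state $m_{\mathsf{init}}\in M$ and an update function $\alpha_{\mathsf{upd}}\colon M\times C\to M$, extended to finite words by $\widehat{\alpha}_{\mathsf{upd}}$. A strategy of $\mathcal P_i$ is a \emph{finite-memory strategy based on} $\mathcal M$ if there is a function $\alpha_{\mathsf{nxt}}\colon M\times S_i\to E$, with $\alpha_{\mathsf{nxt}}(m,s)$ an edge of source $s$, such that the strategy maps each history with sequence of colors $u$ and last state $s\in S_i$ to $\alpha_{\mathsf{nxt}}(\widehat{\alpha}_{\mathsf{upd}}(m_{\mathsf{init}},u),s)$. The product $\mathcal M_1\otimes\mathcal M_2$ has state set $M_1\times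 M_2$, as initial state the pair of initial states, and updates both components in parallel. \textbf{Corollary (lifting).} Let $\sqsubseteq$ be a preference relation and let $\mathcal M_1,\mathcal M_2$ be two memory skeletons. Assume that 1. for every arena $\mathcal A=(S_1,S_2,E)$ with $S_2=\emptyset$, $\mathcal P_1$ has a uniformly-optimal finite-memory strategy based on $\mathcal M_1$ in the game $(\mathcal A,\sqsubseteq)$; 2. for every arena $\mathcal A=(S_1,S_2,E)$ with $S_1=\emptyset$, $\mathcal P_2$ has a uniformly-optimal finite-memory strategy based on $\mathcal M_2$ in the game $(\mathcal A,\sqsubseteq)$. Then, for every arena $\mathcal A=(S_1,S_2,E)$, both $\mathcal P_1$ and $\mathcal P_2$ have uniformly-optimal finite-memory strategies based on $\mathcal M_1\otimes\mathcal M_2$ in the game $(\mathcal A,\sqsubseteq)$. -/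

import Mathlib

/-- The two players. -/
inductive Player : Type
  | one
  | two

/-- The adversary of a player. -/
def Player.opponent : Player → Player
  | .one => .two
  | .two => .one

/-- A (finite, non-blocking) arena with states `S` and colors `C`. The states of player `i`
are the states `s` with `owner s = i`; an edge is a triple (source, color, target). -/
structure Arena (C : Type*) (S : Type*) where
  owner : S → Player
  edges : Set (S × C × S)
  finite_states : Finite S
  finite_edges : edges.Finite
  nonblocking : ∀ s : S, ∃ e ∈ edges, e.1 = s

namespace Arena

variable {C S : Type*} (A : Arena C S)

/-- The edges of an arena, as a type. -/
abbrev Edge : Type _ := {e : S × C × S // e ∈ A.edges}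

variable {A}

/-- The starting state of an edge. -/
def Edge.source (e : A.Edge) : S := e.1.1

/-- The color of an edge. -/
def Edge.col (e : A.Edge) : C := e.1.2.1

/-- The arrival state of an edge. -/
def Edge.target (e : A.Edge) : S := e.1.2.2

/-- `IsWalk s l`: the edges of `l` follow each other, and the first one (if any) starts in `s`. -/
def IsWalk : S → List A.Edge → Prop
  | _, [] => True
  | s, e :: l => Edge.source e = s ∧ IsWalk (Edge.target e) l

variable (A)

/-- Histories: finite sequences of consecutive edges, with their initial state. The empty sequence
of edges gives the empty history at each state. -/
structure History where
  start : S
  path : List A.Edge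
  isWalk : IsWalk start path

variable {A}

/-- The last state of a history. -/
def History.out (ρ : A.History) : S := ρ.path.foldl (fun _ e => Edge.target e) ρ.start

/-- The sequence of colors of a history. -/
def History.col (ρ : A.History) : List C := ρ.path.map Edge.col

variable (A)

/-- The histories whose last state belongs to player `i`. -/
abbrev HistoryOf (i : Player) : Type _ := {ρ : A.History // A.owner ρ.out = i}

/-- A strategy of player `i`: it maps each history whose last state belongs to player `i` to an
edge that starts in this last state. -/
structure Strategy (i : Player) where
  next : A.HistoryOf i → A.Edge
  source_next : ∀ ρ : A.HistoryOf i, Edge.source (next ρ) = ρ.1.out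

/-- The plays from the state `s`. -/
def plays (s : S) : Set (ℕ → A.Edge) :=
  {π | Edge.source (π 0) = s ∧ ∀ n, Edge.target (π n) = Edge.source (π (n + 1))}

variable {A}

/-- The plays from `s` that are consistent with the strategy `σ` of player `i`: after each finite
prefix (the empty one included) whose last state belongs to player `i`, the next edge is the one
that `σ` chooses. -/
def playsOf {i : Player} (s : S) (σ : A.Strategy i) : Set (ℕ → A.Edge) :=
  {π ∈ A.plays s | ∀ (n : ℕ) (ρ : A.HistoryOf i),
    ρ.1.start = s → ρ.1.path = (List.range n).map π → σ.next ρ = π n}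

/-- The plays from `s` that are consistent with a strategy of each player. -/
def jointPlays {i j : Player} (s : S) (σ : A.Strategy i) (τ : A.Strategy j) :
    Set (ℕ → A.Edge) :=
  playsOf s σ ∩ playsOf s τ

/-- The infinite word of the colors of a play. -/
def colPlay (π : ℕ → A.Edge) : ℕ → C := fun n => Edge.col (π n)

/-- The extension of a relation on infinite words to sets of infinite words. -/
def setPref (pref : (ℕ → C) → (ℕ → C) → Prop) (W W' : Set (ℕ → C)) : Prop :=
  ∀ w ∈ W, ∃ w' ∈ W', pref w w'

/-- The upward closure of the words that can occur when the strategy `σ` is used from `s`. -/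
def UCol (pref : (ℕ → C) → (ℕ → C) → Prop) {i : Player} (s : S) (σ : A.Strategy i) :
    Set (ℕ → C) :=
  {w | ∃ τ : A.Strategy i.opponent, setPref pref (colPlay '' jointPlays s σ τ) {w}}

/-- The downward closure of the words that can occur when the strategy `σ` is used from `s`. -/
def DCol (pref : (ℕ → C) → (ℕ → C) → Prop) {i : Player} (s : S) (σ : A.Strategy i) :
    Set (ℕ → C) :=
  {w | ∃ τ : A.Strategy i.opponent, setPref pref {w} (colPlay '' jointPlays s σ τ)}

/-- `σ` is at least as good as `σ'` from `s`, for the player who owns both strategies: player 1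
wants good plays for `pref`, player 2 wants bad ones. -/
def AtLeastAsGood (pref : (ℕ → C) → (ℕ → C) → Prop) (s : S) :
    {i : Player} → A.Strategy i → A.Strategy i → Prop
  | .one, σ, σ' => UCol pref s σ ⊆ UCol pref s σ'
  | .two, σ, σ' => DCol pref s σ ⊆ DCol pref s σ'

/-- `σ` is optimal from the state `s`. -/
def Optimal (pref : (ℕ → C) → (ℕ → C) → Prop) {i : Player} (s : S) (σ : A.Strategy i) : Prop :=
  ∀ σ' : A.Strategy i, AtLeastAsGood pref s σ σ'

/-- `σ` is optimal from every state. -/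
def UniformlyOptimal (pref : (ℕ → C) → (ℕ → C) → Prop) {i : Player} (σ : A.Strategy i) : Prop :=
  ∀ s : S, Optimal pref s σ

end Arena

/-- A memory skeleton with (finitely many) states `M`, reading colors in `C`. -/
structure MemorySkeleton (C : Type*) (M : Type*) where
  init : M
  upd : M → C → M
  finite_states : Finite M

namespace MemorySkeleton

variable {C M M' : Type*}

/-- The extension of the update function to finite words. -/
def updStar (K : MemorySkeleton C M) (m : M) (w : List C) : M := w.foldl K.upd m

/-- The product of two memory skeletons: both memories are updated in parallel. -/
def prod (K : MemorySkeleton C M) (K' : MemorySkeleton C M') : MemorySkeleton C (M × M') where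
  init := (K.init, K'.init)
  upd m c := (K.upd m.1 c, K'.upd m.2 c)
  finite_states :=
    haveI := K.finite_states
    haveI := K'.finite_states
    inferInstance

end MemorySkeleton

/-- A Mealy machine for player `i` on the arena `A`: the memory skeleton `K` with a next-action
function. -/
structure MealyMachine {C S M : Type*} (A : Arena C S) (i : Player) (K : MemorySkeleton C M) where
  nxt : M → {s : S // A.owner s = i} → A.Edge
  source_nxt : ∀ m s, Arena.Edge.source (nxt m s) = s.1

/-- The strategy that a Mealy machine encodes. -/
def MealyMachine.toStrategy {C S M : Type*} {A : Arena C S} {i : Player} {K : MemorySkeleton C M}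
    (Γ : MealyMachine A i K) : A.Strategy i where
  next ρ := Γ.nxt (K.updStar K.init ρ.1.col) ⟨ρ.1.out, ρ.2⟩
  source_next ρ := Γ.source_nxt _ _

namespace Arena

variable {C S M : Type*}

/-- The strategy `σ` can be encoded as a Mealy machine with memory skeleton `K`. -/
def Strategy.BasedOn {A : Arena C S} {i : Player} (σ : A.Strategy i) (K : MemorySkeleton C M) :
    Prop :=
  ∃ Γ : MealyMachine A i K, σ = Γ.toStrategy

/-- In the game on `A` with preference relation `pref`, player `i` has a uniformly-optimal
finite-memory strategy based on the memory skeleton `K`. -/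
def HasUFM (A : Arena C S) (pref : (ℕ → C) → (ℕ → C) → Prop) (i : Player)
    (K : MemorySkeleton C M) : Prop :=
  ∃ σ : A.Strategy i, σ.BasedOn K ∧ UniformlyOptimal pref σ

end Arena

universe u v w₁ w₂

/-!
# Lifting finite-memory determinacy from one-player to two-player arenas

Multiply the arena by the memory skeleton: finite-memory strategies become positional strategies on
a finite graph whose vertices are labelled by memory states (`CoveredGraph`, `Arena.product`). The
argument has two halves.

*One player* (`positionalMax_of_hasUFM`). On a covered graph where a single player moves, some
positional strategy is optimal from every vertex `v`, and stays optimal when the play is preceded by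
any finite word `w` that takes the initial memory state to the label of `v`. Indeed, attach to the
graph paths that read such words and end in the corresponding vertices: the finite-memory strategy
that the hypothesis gives for this larger arena is positional on the original graph. As there are
only finitely many positional strategies, finitely many words suffice to rule out all those that
are not optimal.

*Two players* (`hasEquilibrium`). Positional equilibria, again valid after all prefixes, exist
by induction on the number of edges. If a player has no choice at all, this is the one-player case.
Otherwise a player has a vertex `s` with several outgoing edges. Split these edges into two classes;
both resulting subgraphs have equilibria by induction. Let the adversary use the equilibrium
strategy of the subgraph to which the last choice at `s` belongs. Against it, the player
moves in a one-player game on two copies of the graph joined at `s`, and a positional optimum of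
that game remains in one copy, hence does no better than the equilibrium there
(`hasPositionalOptimum_of_split`). So each player has an optimal positional strategy, although the
adversary's strategy that shows its optimality needs one bit of memory. Two such
strategies form an equilibrium (`HasPositionalOptimum.hasEquilibrium`).
-/

/-! ### Positional play on finite graphs labelled by a memory skeleton -/

/-- The infinite word `w · x`. -/
def prependWord {C : Type*} : List C → (ℕ → C) → ℕ → C
  | [], x => x
  | a :: w, x => fun n => Nat.casesOn n a (prependWord w x)

/-- A finite non-blocking graph with colored edges, whose vertices carry states of the memory
skeleton `K` in such a way that reading the color of an edge updates the label of its source to the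
label of its target. The product of an arena with `K` is the motivating example. -/
structure CoveredGraph {C M : Type*} (K : MemorySkeleton C M) (V : Type*) where
  edges : Set (V × C × V)
  finite_edges : edges.Finite
  nonblocking : ∀ v, ∃ p, (v, p) ∈ edges
  mem : V → M
  mem_edge : ∀ {v c v'}, (v, c, v') ∈ edges → mem v' = K.upd (mem v) c

section Positional

variable {C V : Type*}

/-- The `x n` are the vertices and the `c n` the colors of an infinite path with edges in `E`. -/
def IsPath (E : Set (V × C × V)) (x : ℕ → V) (c : ℕ → C) : Prop :=
  ∀ n, (x n, c n, x (n + 1)) ∈ E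

/-- The path `x, c` takes the edge prescribed by `f` whenever it is in a vertex of `P`. -/
def Follows (f : V → C × V) (P : V → Prop) (x : ℕ → V) (c : ℕ → C) : Prop :=
  ∀ n, P (x n) → (c n, x (n + 1)) = f (x n)

/-- The vertices visited from `v` when every vertex `u` is left by the edge `(u, f u)`. -/
def posVertex (f : V → C × V) (v : V) (n : ℕ) : V := (fun u => (f u).2)^[n] v

/-- The colors seen from `v` when every vertex `u` is left by the edge `(u, f u)`. -/
def posWord (f : V → C × V) (v : V) (n : ℕ) : C := (f (posVertex f v n)).1

theorem posVertex_zero (f : V → C × V) (v : V) : posVertex f v 0 = v := rfl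

theorem posVertex_succ (f : V → C × V) (v : V) (n : ℕ) :
    posVertex f v (n + 1) = (f (posVertex f v n)).2 :=
  Function.iterate_succ_apply' _ _ _

theorem pos_step (f : V → C × V) (v : V) (n : ℕ) :
    (posWord f v n, posVertex f v (n + 1)) = f (posVertex f v n) := by
  rw [posVertex_succ]; rfl

theorem isPath_pos {E : Set (V × C × V)} {f : V → C × V} (hf : ∀ v, (v, f v) ∈ E) (v : V) :
    IsPath E (posVertex f v) (posWord f v) := fun n => by
  rw [pos_step]; exact hf _

theorem Follows.eq_posWord {f : V → C × V} {x : ℕ → V} {c : ℕ → C}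
    (h : Follows f (fun _ => True) x c) : c = posWord f (x 0) := by
  have hx : ∀ n, x n = posVertex f (x 0) n := by
    intro n
    induction n with
    | zero => rfl
    | succ n ih => rw [posVertex_succ, ← ih, ← h n trivial]
  funext n
  rw [posWord, ← hx, ← h n trivial]

end Positional

/-- Every covered graph, seen as a game of a single player who prefers large words for `R`, has a
positional strategy that is optimal from every vertex `v`, after every word `w` that leads the
memory to the label of `v`. -/
def PositionalMax.{x, u₁, u₂} {C : Type u₁} {M : Type u₂} (R : (ℕ → C) → (ℕ → C) → Prop)
    (K : MemorySkeleton C M) : Prop :=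
  ∀ (V : Type x) [Finite V] (G : CoveredGraph K V),
    ∃ f : V → C × V, (∀ v, (v, f v) ∈ G.edges) ∧
      ∀ v w, K.updStar K.init w = G.mem v → ∀ x c, IsPath G.edges x c → x 0 = v →
        R (prependWord w c) (prependWord w (posWord f v))

section Equilibrium

variable {C M V : Type*} (R : (ℕ → C) → (ℕ → C) → Prop) {K : MemorySkeleton C M}

/-- The map `f` encodes a positional strategy of the player who owns the vertices in `own` and
prefers large words, and one of the adversary; neither can gain by a deviation, from any vertex
`v` and after any word `w` that leads the memory to the label of `v`. -/
def HasEquilibrium (own : V → Prop) (G : CoveredGraph K V) : Prop :=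
  ∃ f : V → C × V, (∀ v, (v, f v) ∈ G.edges) ∧
    ∀ v w, K.updStar K.init w = G.mem v → ∀ x c, IsPath G.edges x c → x 0 = v →
      (Follows f own x c → R (prependWord w (posWord f v)) (prependWord w c)) ∧
      (Follows f (fun u => ¬ own u) x c → R (prependWord w c) (prependWord w (posWord f v)))

/-- The owner of `own` has an optimal positional strategy `f`. Its optimality is witnessed by a
strategy `h` of the adversary that uses one bit of memory, with initial value `b₀` and update
function `u`: the word `z` is guaranteed by `f`, and `h` guarantees nothing better. -/
def HasPositionalOptimum (own : V → Prop) (G : CoveredGraph K V) : Prop :=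
  ∃ f : V → C × V, (∀ v, (v, f v) ∈ G.edges) ∧
    ∃ (h : Bool → V → C × V) (u : Bool → V → C × V → Bool) (b₀ : V → Bool),
      (∀ b v, (v, h b v) ∈ G.edges) ∧
      ∀ v w, K.updStar K.init w = G.mem v → ∃ z : ℕ → C,
        (∀ x c, IsPath G.edges x c → x 0 = v → Follows f own x c →
          R (prependWord w z) (prependWord w c)) ∧
        ∀ x c (q : ℕ → Bool), IsPath G.edges x c → x 0 = v → q 0 = b₀ v →
          (∀ n, q (n + 1) = u (q n) (x n) (c n, x (n + 1))) →
          (∀ n, ¬ own (x n) → (c n, x (n + 1)) = h (q n) (x n)) →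
          R (prependWord w c) (prependWord w z)

variable {R}

theorem HasEquilibrium.of_flip {own : V → Prop} {G : CoveredGraph K V}
    (h : HasEquilibrium (flip R) (fun v => ¬ own v) G) : HasEquilibrium R own G := by
  obtain ⟨f, hf, H⟩ := h
  refine ⟨f, hf, fun v w hw x c hx h0 => ?_⟩
  have := H v w hw x c hx h0
  simp only [not_not] at this
  exact this.symm

/-- Optimal positional strategies of both players form an equilibrium: the path in which both
players use their witnessing bit strategies shows that the two guaranteed words are equivalent. -/
theorem HasPositionalOptimum.hasEquilibrium [IsPreorder (ℕ → C) R] {own : V → Prop}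
    {G : CoveredGraph K V} (h₁ : HasPositionalOptimum R own G)
    (h₂ : HasPositionalOptimum (flip R) (fun v => ¬ own v) G) : HasEquilibrium R own G := by
  classical
  obtain ⟨f₁, hf₁, s₁, u₁, b₁, hs₁, H₁⟩ := h₁
  obtain ⟨f₂, hf₂, s₂, u₂, b₂, hs₂, H₂⟩ := h₂
  let f : V → C × V := fun v => if own v then f₁ v else f₂ v
  have hf : ∀ v, (v, f v) ∈ G.edges := fun v => by
    by_cases hv : own v <;> simp [f, hv, hf₁, hf₂]
  have hown : ∀ {x c}, Follows f own x c → Follows f₁ own x c := fun h n hn => by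
    simpa [f, hn] using h n hn
  have hopp : ∀ {x c}, Follows f (fun v => ¬ own v) x c → Follows f₂ (fun v => ¬ own v) x c :=
    fun h n hn => by simpa [f, hn] using h n hn
  refine ⟨f, hf, fun v w hw => ?_⟩
  obtain ⟨z₁, hz₁, hz₁'⟩ := H₁ v w hw
  obtain ⟨z₂, hz₂, hz₂'⟩ := H₂ v w hw
  have hz : R (prependWord w z₂) (prependWord w z₁) := by
    let d : V × Bool × Bool → C × V := fun t => if own t.1 then s₂ t.2.2 t.1 else s₁ t.2.1 t.1
    let step : V × Bool × Bool → V × Bool × Bool := fun t =>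
      ((d t).2, u₁ t.2.1 t.1 (d t), u₂ t.2.2 t.1 (d t))
    let y : ℕ → V × Bool × Bool := fun n => step^[n] (v, b₁ v, b₂ v)
    have hy : ∀ n, y (n + 1) = step (y n) := fun n => Function.iterate_succ_apply' _ _ _
    have hd : ∀ n, ((d (y n)).1, (y (n + 1)).1) = d (y n) := fun n => by rw [hy]
    have hpath : IsPath G.edges (fun n => (y n).1) (fun n => (d (y n)).1) := fun n => by
      simp only [hd]
      by_cases hv : own (y n).1 <;> simp [d, hv, hs₁, hs₂]
    have a₁ := hz₁' _ _ (fun n => (y n).2.1) hpath rfl rfl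
      (fun n => by simp only [hd]; rw [hy]) (fun n hn => by simp only [hd]; simp [d, hn])
    have a₂ := hz₂' _ _ (fun n => (y n).2.2) hpath rfl rfl
      (fun n => by simp only [hd]; rw [hy])
      (fun n hn => by simp only [not_not] at hn; simp only [hd]; simp [d, hn])
    exact _root_.trans a₂ a₁
  have hp := isPath_pos hf v
  have hp₁ := hz₁ _ _ hp rfl (hown fun n _ => pos_step f v n)
  have hp₂ : R _ _ := hz₂ _ _ hp rfl (hopp fun n _ => pos_step f v n)
  intro x c hx h0
  refine ⟨fun h => ?_, fun h => ?_⟩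
  · exact _root_.trans hp₂ (_root_.trans hz (hz₁ x c hx h0 (hown h)))
  · have : R _ _ := hz₂ x c hx h0 (hopp h)
    exact _root_.trans this (_root_.trans hz hp₁)

/-- If the owner of `own` never has a choice, the graph is a game of the adversary alone. -/
theorem hasEquilibrium_of_forced.{x} {V : Type x} [Finite V] [IsPreorder (ℕ → C) R]
    (hR : PositionalMax.{x} (flip R) K) {own : V → Prop} (G : CoveredGraph K V)
    (hown : ∀ v p p', own v → (v, p) ∈ G.edges → (v, p') ∈ G.edges → p = p') :
    HasEquilibrium R own G := by
  obtain ⟨f, hf, H⟩ := hR V G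
  refine ⟨f, hf, fun v w hw x c hx h0 => ⟨fun _ => H v w hw x c hx h0, fun h => ?_⟩⟩
  have hc : c = posWord f (x 0) := Follows.eq_posWord fun n _ => by
    by_cases hn : own (x n)
    · exact hown _ _ _ hn (hx n) (hf _)
    · exact h n hn
  rw [hc, h0]
  exact refl _

/-- The induction step. Split the edges that leave the vertex `s` of `own` into two classes, which
gives two smaller graphs; let the adversary use the equilibrium strategy of the graph that contains
the edge chosen at the last visit of `s`. What remains is a one-player game on two copies of the
graph that are joined at `s`. It has a positional optimum, which always stays in the same copy. -/
theorem hasPositionalOptimum_of_split.{x} {V : Type x} [Finite V] [IsPreorder (ℕ → C) R]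
    (hR : PositionalMax.{x} R K) {own : V → Prop} (G : CoveredGraph K V)
    (ih : ∀ G' : CoveredGraph K V, G'.edges.ncard < G.edges.ncard → HasEquilibrium R own G')
    {s : V} {p₁ p₂ : C × V} (hs : own s) (hp₁ : (s, p₁) ∈ G.edges) (hp₂ : (s, p₂) ∈ G.edges)
    (hne : p₁ ≠ p₂) : HasPositionalOptimum R own G := by
  classical
  let κ : C × V → Bool := fun p => decide (p = p₁)
  let Gs : Bool → CoveredGraph K V := fun b =>
    { edges := {e | e ∈ G.edges ∧ (e.1 = s → κ e.2 = b)}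
      finite_edges := G.finite_edges.subset fun e he => he.1
      nonblocking := fun v => by
        by_cases hv : v = s
        · subst hv
          cases b
          · exact ⟨p₂, hp₂, fun _ => by simp [κ, hne.symm]⟩
          · exact ⟨p₁, hp₁, fun _ => by simp [κ]⟩
        · obtain ⟨p, hp⟩ := G.nonblocking v
          exact ⟨p, hp, fun h => absurd h hv⟩
      mem := G.mem
      mem_edge := fun h => G.mem_edge h.1 }
  have hlt : ∀ b, (Gs b).edges.ncard < G.edges.ncard := fun b => by
    refine Set.ncard_lt_ncard ⟨fun e he => he.1, fun h => ?_⟩ G.finite_edges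
    have e₁ := (h hp₁).2 rfl
    have e₂ := (h hp₂).2 rfl
    rw [← e₂] at e₁
    simp [κ, hne.symm] at e₁
  choose f hf H using fun b => ih (Gs b) (hlt b)
  -- the copy in which the path is after the edge `(v, p)`, if it was in the copy `b` before
  let β : Bool → V → C × V → Bool := fun b v p => if v = s then κ p else b
  -- `s` is always represented by its copy `false`
  let u : Bool → V → C × V → Bool := fun b v p => if p.2 = s then false else β b v p
  let Gg : CoveredGraph K (V × Bool) :=
    { edges := {e | (e.1.1, e.2.1, e.2.2.1) ∈ G.edges ∧
        (¬ own e.1.1 → (e.2.1, e.2.2.1) = f e.1.2 e.1.1) ∧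
        e.2.2.2 = u e.1.2 e.1.1 (e.2.1, e.2.2.1)}
      finite_edges := by
        refine Set.Finite.subset ((G.finite_edges.prod (Set.finite_univ (α := Bool × Bool))).image
          fun t => ((t.1.1, t.2.1), t.1.2.1, (t.1.2.2, t.2.2))) ?_
        rintro ⟨⟨v, b⟩, c, v', b'⟩ he
        exact ⟨((v, c, v'), b, b'), ⟨he.1, trivial⟩, rfl⟩
      nonblocking := fun ⟨v, b⟩ => by
        by_cases hv : own v
        · obtain ⟨p, hp⟩ := G.nonblocking v
          exact ⟨(p.1, p.2, u b v p), hp, fun h => absurd hv h, rfl⟩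
        · exact ⟨((f b v).1, (f b v).2, u b v (f b v)), (hf b v).1, fun _ => rfl, rfl⟩
      mem := fun t => G.mem t.1
      mem_edge := fun h => G.mem_edge h.1 }
  obtain ⟨g, hg, Hg⟩ := hR (V × Bool) Gg
  set b' : Bool := κ ((g (s, false)).1, (g (s, false)).2.1) with hb'
  let b₀ : V → Bool := fun v => if v = s then false else b'
  refine ⟨f b', fun v => (hf b' v).1, f, u, b₀, fun b v => (hf b v).1, fun v w hw => ?_⟩
  refine ⟨posWord (f b') v, fun x c hx h0 hfol => ?_, fun x c q hx h0 hq0 hq hfol => ?_⟩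
  · refine ((H b' v w hw x c (fun n => ⟨hx n, fun hn => ?_⟩) h0).1 hfol)
    have hn' : x n = s := hn
    rw [hfol n (hn' ▸ hs)]
    exact (hf b' (x n)).2 hn
  · refine _root_.trans (Hg (v, b₀ v) w hw (fun n => (x n, q n)) c
      (fun n => ⟨hx n, hfol n, hq n⟩) (by simp [h0, hq0])) ?_
    have hpath := isPath_pos hg (v, b₀ v)
    have hstep := pos_step g (v, b₀ v)
    have hy0 := posVertex_zero g (v, b₀ v)
    generalize posVertex g (v, b₀ v) = y at hpath hstep hy0
    generalize posWord g (v, b₀ v) = d at hpath hstep ⊢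
    have hβ : ∀ n, (y n).2 = b₀ (y n).1 → β (y n).2 (y n).1 (d n, (y (n + 1)).1) = b' := by
      intro n hn
      by_cases hv : (y n).1 = s
      · have hyn : y n = (s, false) := Prod.ext hv (by simp [hn, b₀, hv])
        have := hstep n
        rw [hyn] at this
        simp [β, hv, hb', ← this]
      · simp [β, hv, hn, b₀]
    have hinv : ∀ n, (y n).2 = b₀ (y n).1 := by
      intro n
      induction n with
      | zero => rw [hy0]
      | succ n ih =>
        rw [(hpath n).2.2]
        change (if (y (n + 1)).1 = s then false else β (y n).2 (y n).1 (d n, (y (n + 1)).1)) = _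
        rw [hβ n ih]
    refine (H b' v w hw (fun n => (y n).1) d (fun n => ⟨(hpath n).1, fun hv => ?_⟩)
      (by simp [hy0])).2 fun n hn => ?_
    · have hv' : (y n).1 = s := hv
      have := hβ n (hinv n)
      simpa only [β, if_pos hv'] using this
    · have hv : (y n).1 ≠ s := fun h => hn (show own (y n).1 by rwa [h])
      have : (y n).2 = b' := by rw [hinv n]; simp [b₀, hv]
      rw [← this]
      exact (hpath n).2.1 hn

theorem hasEquilibrium.{x} {V : Type x} [Finite V] [IsPreorder (ℕ → C) R]
    (hR : PositionalMax.{x} R K) (hR' : PositionalMax.{x} (flip R) K) (own : V → Prop)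
    (G : CoveredGraph K V) : HasEquilibrium R own G := by
  induction hn : G.edges.ncard using Nat.strong_induction_on generalizing G with
  | _ n ih =>
    have : IsPreorder (ℕ → C) (flip R) :=
      { refl := fun a => refl (r := R) a
        trans := fun _ _ _ h h' => _root_.trans (r := R) h' h }
    have ih₁ : ∀ G' : CoveredGraph K V, G'.edges.ncard < G.edges.ncard → HasEquilibrium R own G' :=
      fun G' h => ih _ (hn ▸ h) G' rfl
    by_cases h₁ : ∀ v p p', own v → (v, p) ∈ G.edges → (v, p') ∈ G.edges → p = p'
    · exact hasEquilibrium_of_forced hR' G h₁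
    by_cases h₂ : ∀ v p p', ¬ own v → (v, p) ∈ G.edges → (v, p') ∈ G.edges → p = p'
    · exact .of_flip (hasEquilibrium_of_forced (R := flip R) hR G h₂)
    push Not at h₁ h₂
    obtain ⟨s, p, p', hs, hp, hp', hne⟩ := h₁
    obtain ⟨t, r, r', ht, hr, hr', hne'⟩ := h₂
    refine (hasPositionalOptimum_of_split hR G ih₁ hs hp hp' hne).hasEquilibrium
      (hasPositionalOptimum_of_split hR' G (fun G' h => ?_) ht hr hr' hne')
    have : HasEquilibrium R (fun v => ¬ ¬ own v) G' := by simpa only [not_not] using ih₁ G' h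
    exact .of_flip this

end Equilibrium

/-! ### Outcomes of strategies and Mealy machines -/

/-- The relation that orders the words by how much player `i` likes them. -/
def Player.rel {C : Type*} (pref : (ℕ → C) → (ℕ → C) → Prop) :
    Player → (ℕ → C) → (ℕ → C) → Prop
  | .one => pref
  | .two => flip pref

theorem Player.flip_rel {C : Type*} (pref : (ℕ → C) → (ℕ → C) → Prop) (i : Player) :
    flip (i.rel pref) = i.opponent.rel pref := by
  cases i <;> rfl

instance Player.isPreorder_rel {C : Type*} (pref : (ℕ → C) → (ℕ → C) → Prop)
    [IsPreorder (ℕ → C) pref] (i : Player) : IsPreorder (ℕ → C) (i.rel pref) := by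
  cases i
  · exact ‹_›
  · exact { refl := fun a => refl (r := pref) a
            trans := fun _ _ _ h h' => _root_.trans (r := pref) h' h }

theorem Player.eq_opponent_iff {i j : Player} : j = i.opponent ↔ j ≠ i := by
  cases i <;> cases j <;> simp [Player.opponent]

namespace Arena

variable {C S M : Type*} {A : Arena C S}

theorem IsWalk.concat {s : S} {l : List A.Edge} {e : A.Edge} (h : A.IsWalk s l)
    (he : Edge.source e = l.foldl (fun _ e => Edge.target e) s) : A.IsWalk s (l ++ [e]) := by
  induction l generalizing s with
  | nil => exact ⟨he, trivial⟩
  | cons a l ih => exact ⟨h.1, ih h.2 he⟩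

theorem History.ext_of_start_of_path {ρ ρ' : A.History} (h : ρ.start = ρ'.start)
    (h' : ρ.path = ρ'.path) : ρ = ρ' := by
  cases ρ; cases ρ'; simp_all

/-- The history `ρ` followed by the edge `e`. -/
def History.snoc (ρ : A.History) (e : A.Edge) (he : Edge.source e = ρ.out) : A.History :=
  ⟨ρ.start, ρ.path ++ [e], ρ.isWalk.concat he⟩

theorem foldl_target_range {s : S} {π : ℕ → A.Edge} (hπ : π ∈ A.plays s) (n : ℕ) :
    ((List.range n).map π).foldl (fun _ e => Edge.target e) s = Edge.source (π n) := by
  cases n with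
  | zero => exact hπ.1.symm
  | succ n => simp [List.range_succ, hπ.2 n]

theorem isWalk_range {s : S} {π : ℕ → A.Edge} (hπ : π ∈ A.plays s) (n : ℕ) :
    A.IsWalk s ((List.range n).map π) := by
  induction n with
  | zero => exact trivial
  | succ n ih =>
    rw [List.range_succ, List.map_append]
    exact ih.concat (foldl_target_range hπ n).symm

section Outcome

variable {i : Player} (s : S) (σ : A.Strategy i) (τ : A.Strategy i.opponent)

open Classical in
/-- The edge that is taken after the history `ρ`. -/
noncomputable def jointNext (ρ : A.History) : A.Edge :=
  if h : A.owner ρ.out = i then σ.next ⟨ρ, h⟩ else τ.next ⟨ρ, Player.eq_opponent_iff.2 h⟩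

theorem source_jointNext (ρ : A.History) : Edge.source (jointNext σ τ ρ) = ρ.out := by
  unfold jointNext
  split
  · exact σ.source_next _
  · exact τ.source_next _

/-- The history of length `n` that is consistent with both strategies. -/
noncomputable def jointHistory : ℕ → A.History
  | 0 => ⟨s, [], trivial⟩
  | n + 1 => (jointHistory n).snoc (jointNext σ τ (jointHistory n)) (source_jointNext σ τ _)

/-- The play from `s` that is consistent with both strategies. -/
noncomputable def outcome (n : ℕ) : A.Edge := jointNext σ τ (jointHistory s σ τ n)

theorem jointHistory_start (n : ℕ) : (jointHistory s σ τ n).start = s := by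
  induction n with
  | zero => rfl
  | succ n ih => exact ih

theorem jointHistory_path (n : ℕ) :
    (jointHistory s σ τ n).path = (List.range n).map (outcome s σ τ) := by
  induction n with
  | zero => rfl
  | succ n ih =>
    rw [List.range_succ, List.map_append, ← ih]
    rfl

theorem jointPlays_eq_singleton : jointPlays s σ τ = {outcome s σ τ} := by
  have key : ∀ (π : ℕ → A.Edge) n (ρ : A.History), ρ.start = s →
      ρ.path = (List.range n).map π → (List.range n).map π = (jointHistory s σ τ n).path →
      ρ = jointHistory s σ τ n := fun π n ρ h h' h'' =>
    History.ext_of_start_of_path (h.trans (jointHistory_start s σ τ n).symm) (h'.trans h'')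
  refine Set.eq_singleton_iff_unique_mem.2 ⟨?_, fun π hπ => ?_⟩
  · have hplay : outcome s σ τ ∈ A.plays s :=
      ⟨source_jointNext σ τ _, fun n => by
        rw [outcome, outcome, source_jointNext]
        simp [jointHistory, History.snoc, History.out]⟩
    refine ⟨⟨hplay, fun n ρ h h' => ?_⟩, hplay, fun n ρ h h' => ?_⟩
    · obtain ⟨ρ, hρ⟩ := ρ
      obtain rfl := key _ n ρ h h' (jointHistory_path s σ τ n).symm
      rw [outcome, jointNext, dif_pos hρ]
    · obtain ⟨ρ, hρ⟩ := ρ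
      obtain rfl := key _ n ρ h h' (jointHistory_path s σ τ n).symm
      rw [outcome, jointNext, dif_neg (Player.eq_opponent_iff.1 hρ)]
  · have step : ∀ n, (List.range n).map π = (jointHistory s σ τ n).path →
        π n = outcome s σ τ n := fun n hn => by
      by_cases h : A.owner (jointHistory s σ τ n).out = i
      · rw [outcome, jointNext, dif_pos h]
        exact (hπ.1.2 n ⟨_, h⟩ (jointHistory_start s σ τ n) hn.symm).symm
      · rw [outcome, jointNext, dif_neg h]
        exact (hπ.2.2 n ⟨_, _⟩ (jointHistory_start s σ τ n) hn.symm).symm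
    have hist : ∀ n, (List.range n).map π = (jointHistory s σ τ n).path := by
      intro n
      induction n with
      | zero => rfl
      | succ n ih =>
        rw [jointHistory_path] at ih ⊢
        rw [List.range_succ, List.map_append, List.map_append, ih,
          List.map_singleton, List.map_singleton, step n (by rw [ih, jointHistory_path])]
    exact funext fun n => step n (hist n)

end Outcome

theorem optimal_iff {pref : (ℕ → C) → (ℕ → C) → Prop} {i : Player} {s : S} {σ : A.Strategy i} :
    Optimal pref s σ ↔ ∀ (σ' : A.Strategy i) (w : ℕ → C) (τ : A.Strategy i.opponent),
      i.rel pref (colPlay (outcome s σ τ)) w → ∃ τ', i.rel pref (colPlay (outcome s σ' τ')) w := by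
  cases i <;>
    simp only [Optimal, AtLeastAsGood, UCol, DCol, setPref, Set.subset_def, Set.mem_ofPred_eq,
      jointPlays_eq_singleton, Set.image_singleton, Set.mem_singleton_iff, forall_eq,
      exists_eq_left, forall_exists_index, Player.rel, flip]

/-- A strategy that follows the play `π` as long as possible. -/
theorem exists_strategy_of_play {s : S} {π : ℕ → A.Edge} (hπ : π ∈ A.plays s) (i : Player) :
    ∃ σ : A.Strategy i, π ∈ playsOf s σ := by
  classical
  choose g hg hg' using A.nonblocking
  refine ⟨⟨fun ρ => if Edge.source (π ρ.1.path.length) = ρ.1.out then π ρ.1.path.length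
    else ⟨g ρ.1.out, hg _⟩, fun ρ => ?_⟩, hπ, fun n ρ h h' => ?_⟩
  · split
    · assumption
    · exact hg' _
  · have : ρ.1.out = Edge.source (π n) := by
      rw [History.out, h, h', foldl_target_range hπ]
    simp [h', this]

/-- A play is consistent with a Mealy machine iff the machine chooses the next edge correctly. -/
theorem mem_playsOf_toStrategy_iff {K : MemorySkeleton C M} {i : Player} {Γ : MealyMachine A i K}
    {s : S} {π : ℕ → A.Edge} (hπ : π ∈ A.plays s) :
    π ∈ playsOf s Γ.toStrategy ↔ ∀ n (h : A.owner (Edge.source (π n)) = i),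
      Γ.nxt (K.updStar K.init ((List.range n).map (colPlay π))) ⟨Edge.source (π n), h⟩ = π n := by
  have aux : ∀ n (ρ : A.HistoryOf i) (hρ : ρ.1.start = s) (hp : ρ.1.path = (List.range n).map π)
      (h : A.owner (Edge.source (π n)) = i), Γ.toStrategy.next ρ =
      Γ.nxt (K.updStar K.init ((List.range n).map (colPlay π))) ⟨Edge.source (π n), h⟩ := by
    intro n ρ hρ hp h
    have hout : ρ.1.out = Edge.source (π n) := by
      rw [History.out, hρ, hp, foldl_target_range hπ]
    have hcol : ρ.1.col = (List.range n).map (colPlay π) := by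
      rw [History.col, hp, List.map_map]
      rfl
    simp only [MealyMachine.toStrategy, hout, hcol]
  constructor
  · intro h n hn
    have hout : (⟨s, _, isWalk_range hπ n⟩ : A.History).out = Edge.source (π n) :=
      foldl_target_range hπ n
    have := h.2 n ⟨⟨s, _, isWalk_range hπ n⟩, by rwa [hout]⟩ rfl rfl
    rwa [aux n _ rfl rfl hn] at this
  · refine fun h => ⟨hπ, fun n ρ hρ hp => ?_⟩
    have hn : A.owner (Edge.source (π n)) = i := by
      rw [← ρ.2, History.out, hρ, hp, foldl_target_range hπ]
    rw [aux n ρ hρ hp hn, h n hn]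

/-- The play with states `x n` and colors `c n`. -/
def playOfPath {x : ℕ → S} {c : ℕ → C} (h : IsPath A.edges x c) (n : ℕ) : A.Edge := ⟨_, h n⟩

theorem playOfPath_mem {x : ℕ → S} {c : ℕ → C} (h : IsPath A.edges x c) :
    playOfPath h ∈ A.plays (x 0) := ⟨rfl, fun _ => rfl⟩

/-- A uniformly optimal finite-memory strategy in an arena with one player, as a function of the
memory state and the vertex. -/
theorem HasUFM.exists_next {pref : (ℕ → C) → (ℕ → C) → Prop} [IsPreorder (ℕ → C) pref]
    {i : Player} {K : MemorySkeleton C M} (hA : ∀ s, A.owner s = i) (h : A.HasUFM pref i K) :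
    ∃ nxt : M → S → C × S, (∀ m s, (s, nxt m s) ∈ A.edges) ∧
      ∀ x c y d (m : ℕ → M), IsPath A.edges x c → IsPath A.edges y d → y 0 = x 0 →
        m 0 = K.init → (∀ n, m (n + 1) = K.upd (m n) (d n)) →
        (∀ n, (d n, y (n + 1)) = nxt (m n) (y n)) → i.rel pref c d := by
  obtain ⟨_, ⟨Γ, rfl⟩, hopt⟩ := h
  have hsrc : ∀ m s, (Γ.nxt m ⟨s, hA s⟩).1 = (s, (Γ.nxt m ⟨s, hA s⟩).1.2) := fun m s =>
    Prod.ext (Γ.source_nxt m _) rfl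
  refine ⟨fun m s => (Γ.nxt m ⟨s, hA s⟩).1.2, fun m s => hsrc m s ▸ (Γ.nxt m ⟨s, hA s⟩).2,
    fun x c y d m hx hy h0 hm0 hm hfol => ?_⟩
  -- the adversary owns no state, so that every play is consistent with all of its strategies
  have hopp : ∀ {s} {π : ℕ → A.Edge} (τ : A.Strategy i.opponent), π ∈ A.plays s →
      π ∈ playsOf s τ := fun τ hπ =>
    ⟨hπ, fun n ρ => absurd (hA _) (Player.eq_opponent_iff.1 ρ.2)⟩
  have hπ := playOfPath_mem hx
  have hπ' := playOfPath_mem hy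
  rw [h0] at hπ'
  obtain ⟨σ', hσ'⟩ := exists_strategy_of_play hπ i
  obtain ⟨τ, -⟩ := exists_strategy_of_play hπ i.opponent
  obtain ⟨τ', hτ'⟩ := optimal_iff.1 (hopt (x 0)) σ' _ τ (refl _)
  have hmem : ∀ n, m n = K.updStar K.init ((List.range n).map d) := by
    intro n
    induction n with
    | zero => exact hm0
    | succ n ih => rw [hm, ih]; simp [List.range_succ, MemorySkeleton.updStar]
  have e₁ : playOfPath hx ∈ jointPlays (x 0) σ' τ' := ⟨hσ', hopp τ' hπ⟩
  have e₂ : playOfPath hy ∈ jointPlays (x 0) Γ.toStrategy τ := by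
    refine ⟨(mem_playsOf_toStrategy_iff hπ').2 fun n hn => Subtype.ext ?_, hopp τ hπ'⟩
    change (Γ.nxt (K.updStar K.init ((List.range n).map d)) ⟨y n, _⟩).1 = (y n, d n, y (n + 1))
    rw [hsrc, ← hmem, hfol]
  rw [jointPlays_eq_singleton, Set.mem_singleton_iff] at e₁ e₂
  rwa [← e₁, ← e₂] at hτ'

end Arena

/-! ### From arenas of one player to positional strategies on covered graphs -/

section OnePlayer

variable {C M : Type*} {K : MemorySkeleton C M} {pref : (ℕ → C) → (ℕ → C) → Prop} {i : Player}

/-- The hypothesis on arenas of one player, for finite graphs with vertices in any universe. -/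
theorem exists_next_of_hasUFM [IsPreorder (ℕ → C) pref]
    (H : ∀ (S : Type v) (A : Arena C S), (∀ s, A.owner s = i) → A.HasUFM pref i K)
    {T : Type*} [Finite T] {E : Set (T × C × T)} (hfin : E.Finite) (hE : ∀ t, ∃ p, (t, p) ∈ E) :
    ∃ nxt : M → T → C × T, (∀ m t, (t, nxt m t) ∈ E) ∧
      ∀ x c y d (m : ℕ → M), IsPath E x c → IsPath E y d → y 0 = x 0 →
        m 0 = K.init → (∀ n, m (n + 1) = K.upd (m n) (d n)) →
        (∀ n, (d n, y (n + 1)) = nxt (m n) (y n)) → i.rel pref c d := by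
  obtain ⟨n, ⟨e₀⟩⟩ := Finite.exists_equiv_fin T
  let e : T ≃ ULift.{v} (Fin n) := e₀.trans Equiv.ulift.symm
  let A : Arena C (ULift.{v} (Fin n)) :=
    { owner := fun _ => i
      edges := (fun t => (e.symm t.1, t.2.1, e.symm t.2.2)) ⁻¹' E
      finite_states := inferInstance
      finite_edges := by
        refine hfin.preimage (Function.Injective.injOn ?_)
        rintro ⟨a, b, c⟩ ⟨a', b', c'⟩ h
        simpa using h
      nonblocking := fun s => by
        obtain ⟨p, hp⟩ := hE (e.symm s)
        exact ⟨(s, p.1, e p.2), by simpa using hp, rfl⟩ }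
  obtain ⟨nxt, hnxt, hopt⟩ := (H _ A fun _ => rfl).exists_next fun _ => rfl
  have hA : ∀ {x c}, IsPath E x c → IsPath A.edges (fun n => e (x n)) c := fun h n => by
    simpa [A] using h n
  refine ⟨fun m t => ((nxt m (e t)).1, e.symm (nxt m (e t)).2), fun m t => ?_,
    fun x c y d m hx hy h0 hm0 hm hfol => ?_⟩
  · simpa [A] using hnxt m (e t)
  · refine hopt _ c _ d m (hA hx) (hA hy) (congrArg e h0) hm0 hm fun n => ?_
    have := hfol n
    simp only [Prod.mk.injEq] at this
    exact Prod.ext this.1 (by simp [this.2])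

theorem prependWord_of_lt {w : List C} {c : ℕ → C} {n : ℕ} (h : n < w.length) :
    prependWord w c n = w[n] := by
  induction w generalizing n with
  | nil => simp at h
  | cons a w ih =>
    cases n with
    | zero => rfl
    | succ n => exact ih (by simpa using h)

theorem prependWord_length_add (w : List C) (c : ℕ → C) (n : ℕ) :
    prependWord w c (w.length + n) = c n := by
  induction w with
  | nil => simp [prependWord]
  | cons a w ih => rw [List.length_cons, Nat.add_right_comm]; exact ih

/-- Otherwise each of the finitely many positional strategies `f` fails at some vertex `v f` after
some word `w f`. Attach to each `v f` a path that reads `w f`: a finite-memory strategy which is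
optimal from the start of all of these paths induces a positional strategy of the original
graph, which cannot fail. -/
theorem positionalMax_of_hasUFM.{x} [IsPreorder (ℕ → C) pref]
    (H : ∀ (S : Type v) (A : Arena C S), (∀ s, A.owner s = i) → A.HasUFM pref i K) :
    PositionalMax.{x} (i.rel pref) K := by
  intro V _ G
  by_contra! hcon
  let ι := {f : V → C × V // ∀ v, (v, f v) ∈ G.edges}
  have : Finite ι := by
    refine Set.Finite.subset (Set.Finite.pi' (t := fun v => {p | (v, p) ∈ G.edges}) fun v =>
      G.finite_edges.preimage (f := fun p => (v, p)) (fun _ _ _ _ h => (Prod.mk.inj h).2)) ?_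
    exact fun f hf => hf
  choose v w hw x c hx hx0 hc using fun f : ι => hcon f.1 f.2
  let node : ∀ (f : ι), ℕ → V ⊕ (Σ f : ι, Fin (w f).length) := fun f k =>
    if h : k < (w f).length then .inr ⟨f, k, h⟩ else .inl (v f)
  let E : Set ((V ⊕ (Σ f : ι, Fin (w f).length)) × C × (V ⊕ (Σ f : ι, Fin (w f).length))) :=
    (fun e => (Sum.inl e.1, e.2.1, Sum.inl e.2.2)) '' G.edges ∪
      Set.range fun t => (Sum.inr t, (w t.1)[t.2], node t.1 (t.2 + 1))
  have hE : ∀ t, ∃ p, (t, p) ∈ E := by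
    rintro (u | t)
    · obtain ⟨p, hp⟩ := G.nonblocking u
      exact ⟨(p.1, .inl p.2), .inl ⟨_, hp, rfl⟩⟩
    · exact ⟨_, .inr ⟨t, rfl⟩⟩
  have hEr : ∀ {t p}, (Sum.inr t, p) ∈ E → p = ((w t.1)[t.2], node t.1 (t.2 + 1)) := by
    rintro t p (⟨_, _, h⟩ | ⟨t', h⟩)
    · simp at h
    · simp only [Prod.mk.injEq, Sum.inr.injEq] at h
      obtain ⟨rfl, h⟩ := h
      exact h.symm
  obtain ⟨nxt, hnxt, hopt⟩ := exists_next_of_hasUFM H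
    (((G.finite_edges.image _).union (Set.finite_range _) : E.Finite)) hE
  have hV : ∀ u, ∃ p : C × V, (u, p) ∈ G.edges ∧ nxt (G.mem u) (.inl u) = (p.1, .inl p.2) := by
    intro u
    obtain (⟨e, he, h⟩ | ⟨_, h⟩) := hnxt (G.mem u) (.inl u)
    · simp only [Prod.mk.injEq, Sum.inl.injEq] at h
      obtain ⟨rfl, h⟩ := h
      exact ⟨e.2, he, h.symm⟩
    · simp at h
  choose g hg hg' using hV
  let f : ι := ⟨g, hg⟩
  -- the path that reads `w f` and then continues with the path `y` of `G`
  let ext : (ℕ → V) → ℕ → V ⊕ (Σ f : ι, Fin (w f).length) := fun y n =>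
    if h : n < (w f).length then .inr ⟨f, n, h⟩ else .inl (y (n - (w f).length))
  have ext_lt : ∀ y n (h : n < (w f).length), ext y n = .inr ⟨f, n, h⟩ := fun y n h => dif_pos h
  have ext_add : ∀ y n, ext y ((w f).length + n) = .inl (y n) := fun y n => by simp [ext]
  have ext_succ : ∀ y n, y 0 = v f → n < (w f).length → ext y (n + 1) = node f (n + 1) := by
    intro y n hy hn
    by_cases h : n + 1 < (w f).length
    · simp [ext, node, h]
    · have : n + 1 - (w f).length = 0 := by omega
      simp [ext, node, h, this, hy]
  have hext : ∀ y d, IsPath G.edges y d → y 0 = v f → IsPath E (ext y) (prependWord (w f) d) := by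
    intro y d hy h0 n
    rcases lt_or_ge n (w f).length with h | h
    · rw [ext_lt y n h, ext_succ y n h0 h, prependWord_of_lt h]
      exact .inr ⟨⟨f, n, h⟩, rfl⟩
    · obtain ⟨k, rfl⟩ := Nat.exists_eq_add_of_le h
      rw [add_assoc, ext_add, ext_add, prependWord_length_add]
      exact .inl ⟨_, hy k, rfl⟩
  have hy := isPath_pos hg (v f)
  let m : ℕ → M := fun n => if n < (w f).length then K.updStar K.init ((w f).take n)
    else G.mem (posVertex g (v f) (n - (w f).length))
  have m_le : ∀ n, n ≤ (w f).length → m n = K.updStar K.init ((w f).take n) := by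
    intro n hn
    rcases hn.lt_or_eq with h | rfl
    · exact if_pos h
    · simp [m, hw, posVertex_zero]
  have m_add : ∀ n, m ((w f).length + n) = G.mem (posVertex g (v f) n) := fun n => by simp [m]
  refine hc f (hopt _ _ _ _ m (hext _ _ (hx f) (hx0 f)) (hext _ _ hy rfl) ?_ ?_ ?_ ?_)
  · by_cases h : 0 < (w f).length
    · simp [ext, h]
    · simp [ext, h, hx0, posVertex_zero]
  · rw [m_le 0 (Nat.zero_le _)]
    rfl
  · intro n
    rcases lt_or_ge n (w f).length with h | h
    · rw [m_le _ h, m_le _ h.le, prependWord_of_lt h, List.take_succ_eq_append_getElem h,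
        MemorySkeleton.updStar, List.foldl_append]
      rfl
    · obtain ⟨k, rfl⟩ := Nat.exists_eq_add_of_le h
      rw [add_assoc, m_add, m_add, prependWord_length_add]
      exact G.mem_edge (hy k)
  · intro n
    rcases lt_or_ge n (w f).length with h | h
    · rw [ext_lt _ n h, hEr (hnxt _ _), ext_succ _ n rfl h, prependWord_of_lt h]
      rfl
    · obtain ⟨k, rfl⟩ := Nat.exists_eq_add_of_le h
      rw [add_assoc, m_add, ext_add, ext_add, prependWord_length_add, hg', ← pos_step g]

end OnePlayer

/-! ### The product of an arena and a memory skeleton -/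

section Product

variable {C S M : Type*}

/-- The product of the arena `A` with the memory skeleton `K`. -/
def Arena.product (A : Arena C S) (K : MemorySkeleton C M) : CoveredGraph K (S × M) where
  edges := {e | (e.1.1, e.2.1, e.2.2.1) ∈ A.edges ∧ e.2.2.2 = K.upd e.1.2 e.2.1}
  finite_edges := by
    have := K.finite_states
    refine Set.Finite.subset ((A.finite_edges.prod (Set.finite_univ (α := M))).image
      fun t => ((t.1.1, t.2), t.1.2.1, (t.1.2.2, K.upd t.2 t.1.2.1))) ?_
    rintro ⟨⟨s, m⟩, c, s', m'⟩ ⟨h, h'⟩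
    dsimp only at h h'
    subst h'
    exact ⟨((s, c, s'), m), ⟨h, trivial⟩, rfl⟩
  nonblocking := fun ⟨s, m⟩ => by
    obtain ⟨⟨s', c, s''⟩, he, rfl⟩ := A.nonblocking s
    exact ⟨(c, s'', K.upd m c), he, rfl⟩
  mem := Prod.snd
  mem_edge := fun h => h.2

/-- An equilibrium in the product of an arena and a memory skeleton is a Mealy machine for each
player, and these are optimal against each other. -/
theorem Arena.hasUFM_of_hasEquilibrium {A : Arena C S} {K : MemorySkeleton C M}
    {pref : (ℕ → C) → (ℕ → C) → Prop} [IsPreorder (ℕ → C) pref] {i : Player}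
    (h : HasEquilibrium (i.rel pref) (fun t => A.owner t.1 = i) (A.product K)) :
    A.HasUFM pref i K := by
  obtain ⟨f, hf, H⟩ := h
  let Γ : ∀ j, MealyMachine A j K := fun j =>
    { nxt := fun m s => ⟨(s.1, (f (s.1, m)).1, (f (s.1, m)).2.1), (hf (s.1, m)).1⟩
      source_nxt := fun _ _ => rfl }
  -- a play in the arena, as a path in the product
  let x : (ℕ → A.Edge) → ℕ → S × M := fun π n =>
    (Edge.source (π n), K.updStar K.init ((List.range n).map (colPlay π)))
  have hx0 : ∀ {s π}, π ∈ A.plays s → x π 0 = (s, K.init) := fun hπ => Prod.ext hπ.1 rfl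
  have hx : ∀ {s π}, π ∈ A.plays s → IsPath (A.product K).edges (x π) (colPlay π) := by
    intro s π hπ n
    refine ⟨?_, by simp [x, List.range_succ, MemorySkeleton.updStar]⟩
    change (Edge.source (π n), Edge.col (π n), Edge.source (π (n + 1))) ∈ A.edges
    rw [← hπ.2 n]
    exact (π n).2
  have hfol : ∀ {s π} j, π ∈ playsOf s (Γ j).toStrategy →
      Follows f (fun t => A.owner t.1 = j) (x π) (colPlay π) := by
    intro s π j hπ n hn
    have h₁ := (mem_playsOf_toStrategy_iff hπ.1).1 hπ n hn
    have h₂ := (hx hπ.1 n).2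
    have h₃ := (hf (x π n)).2
    have h₄ : (f (x π n)).1 = Edge.col (π n) := congrArg Edge.col h₁
    have h₅ : (f (x π n)).2.1 = Edge.target (π n) := congrArg Edge.target h₁
    refine Prod.ext h₄.symm (Prod.ext (h₅.trans (hπ.1.2 n)).symm ?_)
    rw [h₃, h₄]
    exact h₂
  refine ⟨(Γ i).toStrategy, ⟨Γ i, rfl⟩, fun s => optimal_iff.2 fun σ' w τ hw =>
    ⟨(Γ i.opponent).toStrategy, ?_⟩⟩
  have mem : ∀ (σ : A.Strategy i) τ, outcome s σ τ ∈ jointPlays s σ τ := fun σ τ => by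
    rw [jointPlays_eq_singleton]; rfl
  have hσ := mem (Γ i).toStrategy τ
  have hτ := mem σ' (Γ i.opponent).toStrategy
  refine _root_.trans ((H (s, K.init) [] rfl _ _ (hx hτ.1.1) (hx0 hτ.1.1)).2 ?_)
    (_root_.trans ((H (s, K.init) [] rfl _ _ (hx hσ.1.1) (hx0 hσ.1.1)).1 (hfol i hσ.1)) hw)
  exact fun n hn => hfol _ hτ.2 n (Player.eq_opponent_iff.2 hn)

end Product

/-! ### Lifting to two players -/

section Lifting

variable {C S M M' : Type*} {A : Arena C S} {i : Player} {pref : (ℕ → C) → (ℕ → C) → Prop}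
  {K : MemorySkeleton C M} {K' : MemorySkeleton C M'}

theorem MemorySkeleton.updStar_prod (m : M × M') (w : List C) :
    (K.prod K').updStar m w = (K.updStar m.1 w, K'.updStar m.2 w) := by
  induction w generalizing m with
  | nil => rfl
  | cons a w ih => exact ih _

theorem Arena.HasUFM.prod_left (h : A.HasUFM pref i K) : A.HasUFM pref i (K.prod K') := by
  obtain ⟨_, ⟨Γ, rfl⟩, h⟩ := h
  refine ⟨_, ⟨⟨fun m => Γ.nxt m.1, fun m => Γ.source_nxt m.1⟩, ?_⟩, h⟩
  simp only [MealyMachine.toStrategy, MemorySkeleton.updStar_prod]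
  rfl

theorem Arena.HasUFM.prod_right (h : A.HasUFM pref i K') : A.HasUFM pref i (K.prod K') := by
  obtain ⟨_, ⟨Γ, rfl⟩, h⟩ := h
  refine ⟨_, ⟨⟨fun m => Γ.nxt m.2, fun m => Γ.source_nxt m.2⟩, ?_⟩, h⟩
  simp only [MealyMachine.toStrategy, MemorySkeleton.updStar_prod]
  rfl

end Lifting

theorem corollary1 {C : Type u}
    (pref : (ℕ → C) → (ℕ → C) → Prop) [IsPreorder (ℕ → C) pref] [Std.Total pref]
    {M₁ : Type w₁} {M₂ : Type w₂} (K₁ : MemorySkeleton C M₁) (K₂ : MemorySkeleton C M₂)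
    (h₁ : ∀ (S : Type v) (A : Arena C S), (∀ s, A.owner s = Player.one) →
      A.HasUFM pref Player.one K₁)
    (h₂ : ∀ (S : Type v) (A : Arena C S), (∀ s, A.owner s = Player.two) →
      A.HasUFM pref Player.two K₂)
    (S : Type v) (A : Arena C S) :
    A.HasUFM pref Player.one (K₁.prod K₂) ∧ A.HasUFM pref Player.two (K₁.prod K₂) := by
  have := A.finite_states
  have := (K₁.prod K₂).finite_states
  have hmax : ∀ i : Player, PositionalMax (i.rel pref) (K₁.prod K₂)
    | .one => positionalMax_of_hasUFM fun S A hA => (h₁ S A hA).prod_left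
    | .two => positionalMax_of_hasUFM fun S A hA => (h₂ S A hA).prod_right
  have main : ∀ i : Player, A.HasUFM pref i (K₁.prod K₂) := fun i =>
    Arena.hasUFM_of_hasEquilibrium
      (hasEquilibrium (hmax i) (Player.flip_rel pref i ▸ hmax i.opponent) _ _)
  exact ⟨main .one, main .two⟩
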